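/- Let $N$ be a nonnegative integer, and let $A$ and $B$ be real $N\times N$ matrices with $A$ symmetric and non-negative definite. For $t\in\mathbb{R}$ set $$E(t)=e^{-tB},\qquad C(t)=\int_0^t E(s)\,A\,E(s)^T\,ds,\qquad D(t)=\det C(t).$$ Assume that $C(t)$ is positive definite for every $t>0$ (equivalently, that the Ornstein--Uhlenbeck operator $\operatorname{tr}(A\nabla^2)+\langle Bx,\nabla\rangle$ is hypoelliptic) and that every complex eigenvalue of $B$ is purely imaginary, i.e. $\sigma(B)\subseteq i\mathbb{R}$. For $t>0$ and every integer $p\ge 0$ set $$V_p(t)=\sqrt{(4\pi)^{N+p}\,t^p\,D(t)}.$$ Then $D(t)>0$ for every $t>0$, and there exists a constant $c_d>1$, depending only on $A$ and $B$, such that $$D(2t)\le c_d\,D(t)\qquad\text{for every } t>0,$$ $$\frac{D(R)}{D(r)}\le c_d\left(\frac{R}{r}\right)^{\log_2 c_d}\qquad\text{for all } 0<r\le R,$$ and, for every integer $p\ge 0$, $$V_p(2t)\le 2^{p/2}\sqrt{c_d}\;V_p(t)\qquad\text{for every } t>0,$$ $$\frac{V_p(R)}{V_p(r)}\le \sqrt{c_d}\left(\frac{R}{r}\right)^{Q_p}\qquad\text{for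 all } 0<r\le R,\qquad\text{where } Q_p=\frac{p+\log_2 c_d}{2}.$$ -/

import Mathlib

namespace OrnsteinUhlenbeck

/-- The matrix exponential `E(t) = exp(-tB)`. -/
noncomputable def E {N : ℕ} (B : Matrix (Fin N) (Fin N) ℝ) (t : ℝ) : Matrix (Fin N) (Fin N) ℝ :=
  NormedSpace.exp (-(t • B))

/-- The Kalman matrix `C(t) = ∫₀ᵗ E(s) A E(s)ᵀ ds`, the integral being taken entrywise. -/
noncomputable def C {N : ℕ} (A B : Matrix (Fin N) (Fin N) ℝ) (t : ℝ) :
    Matrix (Fin N) (Fin N) ℝ :=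
  Matrix.of fun i j => ∫ s in (0 : ℝ)..t, (E B s * A * (E B s).transpose) i j

/-- The determinant function `D(t) = det C(t)`. -/
noncomputable def D {N : ℕ} (A B : Matrix (Fin N) (Fin N) ℝ) (t : ℝ) : ℝ :=
  (C A B t).det

/-- The function `V_p(t) = √((4π)^(N+p) t^p D(t))`. -/
noncomputable def V {N : ℕ} (A B : Matrix (Fin N) (Fin N) ℝ) (p : ℕ) (t : ℝ) : ℝ :=
  Real.sqrt ((4 * Real.pi) ^ (N + p) * t ^ p * D A B t)

/-- The exponent `Q_p = (p + log₂ c_d) / 2` attached to a doubling constant `c_d`. -/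
noncomputable def Q (cd : ℝ) (p : ℕ) : ℝ :=
  ((p : ℝ) + Real.logb 2 cd) / 2

end OrnsteinUhlenbeck

/-! Write `q_t(x) = ⟨x, C(t) x⟩`. The semigroup law gives `q_{a+b}(x) = q_a(x) + q_b(E(a)ᵀ x)`, so
doubling amounts to `q_t(E(t)ᵀ x) ≤ const · q_t(x)` uniformly in `t`.

Put `t = N h` and `W = E(h)ᵀ`. Then `q_t(x)` is the sum of `q_h(W^j x)` over `j < N`. By
Cayley–Hamilton, `W^N x` is a combination of these `W^j x`. Since `σ(B) ⊆ iℝ`, the eigenvalues of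
`W` have modulus one, so the coefficients are at most binomial, whatever `h` is. Cauchy–Schwarz
bounds `q_h(W^N x)` by `K q_t(x)`, whence `q_t(W x) ≤ (1 + K) q_t(x)`; `N` iterations reach `E(t)ᵀ =
W^N`.

Monotonicity of the determinant in the Loewner order turns this into doubling for `D`, and dyadic
iteration gives the power growth. -/

namespace OrnsteinUhlenbeck

open Matrix
open scoped Matrix.Norms.Operator

/-! ### Determinants and quadratic forms -/

/-- A real positive semidefinite matrix factors as `Uᵀ U`. -/
theorem exists_eq_transpose_mul_self {n : Type*} [Fintype n] [DecidableEq n] {P : Matrix n n ℝ}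
    (hP : P.PosSemidef) : ∃ U : Matrix n n ℝ, P = Uᵀ * U := by
  have h := hP
  open scoped MatrixOrder Matrix.Norms.L2Operator in
  rw [← Matrix.nonneg_iff_posSemidef] at h
  obtain ⟨U, hU⟩ := CStarAlgebra.nonneg_iff_eq_star_mul_self.mp h
  exact ⟨U, by rw [hU, star_eq_conjTranspose, conjTranspose_eq_transpose_of_trivial]⟩

theorem one_le_det_one_add {n : Type*} [Fintype n] [DecidableEq n] {S : Matrix n n ℝ}
    (hS : S.PosSemidef) : 1 ≤ (1 + S).det := by
  -- Up to sign, `det (1 + S)` is the characteristic polynomial at `-1`, hence the product of the `1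
  -- + λᵢ`.
  have h1 := Matrix.eval_charpoly S (-1)
  have h2 : (scalar n (-1 : ℝ) - S) = -(1 + S) := by
    ext i j; simp [Matrix.one_apply, Matrix.scalar_apply, Matrix.diagonal_apply]
    split_ifs <;> ring
  rw [h2, Matrix.det_neg, hS.1.charpoly_eq, Polynomial.eval_prod] at h1
  have h3 : ∏ i, ((Polynomial.X - Polynomial.C ((hS.1.eigenvalues i : ℝ))).eval (-1 : ℝ))
      = (-1) ^ Fintype.card n * ∏ i, (1 + hS.1.eigenvalues i) := by
    rw [← Finset.card_univ, ← Finset.prod_const, ← Finset.prod_mul_distrib]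
    refine Finset.prod_congr rfl fun i _ => ?_
    simp; ring
  have h4 : (1 + S).det = ∏ i, (1 + hS.1.eigenvalues i) :=
    (mul_left_cancel₀ (pow_ne_zero _ (by norm_num)) (h3.symm.trans h1)).symm
  rw [h4]
  exact Finset.one_le_prod fun i => by simpa using hS.eigenvalues_nonneg i

/-- The determinant is monotone for the Loewner order above a positive definite matrix. -/
theorem det_le_det_add {n : Type*} [Fintype n] [DecidableEq n] {P S : Matrix n n ℝ}
    (hP : P.PosDef) (hS : S.PosSemidef) : P.det ≤ (P + S).det := by
  obtain ⟨U, hU⟩ := exists_eq_transpose_mul_self hP.posSemidef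
  have hdet : U.det ≠ 0 := by
    intro h
    have := hP.det_pos
    rw [hU, det_mul, h, mul_zero] at this
    exact lt_irrefl _ this
  have hu : IsUnit U.det := isUnit_iff_ne_zero.mpr hdet
  have hT := hS.conjTranspose_mul_mul_same U⁻¹
  rw [conjTranspose_eq_transpose_of_trivial] at hT
  -- Congruence by `U⁻¹` reduces to the case `P = 1`.
  have h : P + S = Uᵀ * (1 + (U⁻¹)ᵀ * S * U⁻¹) * U := by
    rw [mul_add, add_mul, mul_one, ← hU]
    congr 1
    have e1 : Uᵀ * (U⁻¹)ᵀ = 1 := by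
      rw [← transpose_mul, nonsing_inv_mul _ hu, transpose_one]
    calc S = (Uᵀ * (U⁻¹)ᵀ) * S * (U⁻¹ * U) := by rw [e1, nonsing_inv_mul _ hu]; simp
      _ = _ := by simp only [Matrix.mul_assoc]
  have h1 := one_le_det_one_add hT
  rw [h, det_mul, det_mul]
  calc P.det = P.det * 1 := (mul_one _).symm
    _ ≤ P.det * (1 + (U⁻¹)ᵀ * S * U⁻¹).det := by gcongr; exact hP.det_pos.le
    _ = _ := by rw [hU, det_mul]; ring

theorem det_le_det_of_quadraticForm_le {n : Type*} [Fintype n] [DecidableEq n]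
    {P R : Matrix n n ℝ} (hP : P.PosDef) (hR : R.IsHermitian)
    (h : ∀ x : n → ℝ, x ⬝ᵥ (P *ᵥ x) ≤ x ⬝ᵥ (R *ᵥ x)) : P.det ≤ R.det := by
  have hS : (R - P).PosSemidef :=
    Matrix.PosSemidef.of_dotProduct_mulVec_nonneg (hR.sub hP.1) fun x => by
      simpa [sub_mulVec, dotProduct_sub] using h x
  simpa using det_le_det_add hP hS

/-- Cauchy–Schwarz for the quadratic form of a positive semidefinite matrix. -/
theorem quadraticForm_sum_smul_le {n ι : Type*} [Fintype n] [DecidableEq n] {G : Matrix n n ℝ}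
    (hG : G.PosSemidef) (s : Finset ι) (c : ι → ℝ) (y : ι → n → ℝ) :
    (∑ j ∈ s, c j • y j) ⬝ᵥ (G *ᵥ (∑ j ∈ s, c j • y j)) ≤
      (∑ j ∈ s, c j ^ 2) * ∑ j ∈ s, y j ⬝ᵥ (G *ᵥ y j) := by
  obtain ⟨U, rfl⟩ := exists_eq_transpose_mul_self hG
  have key : ∀ v : n → ℝ, v ⬝ᵥ ((Uᵀ * U) *ᵥ v) = ∑ i, (U *ᵥ v) i ^ 2 := by
    intro v
    rw [← mulVec_mulVec, dotProduct_mulVec, vecMul_transpose]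
    simp [dotProduct, sq]
  simp only [key]
  rw [Finset.sum_comm, Finset.mul_sum]
  refine Finset.sum_le_sum fun i _ => ?_
  have : (U *ᵥ ∑ j ∈ s, c j • y j) i = ∑ j ∈ s, c j * (U *ᵥ y j) i := by
    rw [Matrix.mulVec_sum]
    simp [mulVec_smul]
  rw [this]
  exact Finset.sum_mul_sq_le_sq_mul_sq _ _ _

/-! ### Spectrum of the exponential -/

theorem exp_mulVec_of_mulVec_eq_smul {n : Type*} [Fintype n] [DecidableEq n]
    {T : Matrix n n ℂ} {v : n → ℂ} {l : ℂ} (h : T *ᵥ v = l • v) :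
    NormedSpace.exp T *ᵥ v = Complex.exp l • v := by
  have hp : ∀ k : ℕ, (T ^ k) *ᵥ v = l ^ k • v := by
    intro k
    induction k with
    | zero => simp
    | succ k ih => rw [pow_succ, ← mulVec_mulVec, h, mulVec_smul, ih, smul_smul, pow_succ']
  have h1 := NormedSpace.exp_series_hasSum_exp' (𝕂 := ℂ) T
  have hc : Continuous fun M : Matrix n n ℂ => M *ᵥ v := by fun_prop
  have h2 := h1.map (Matrix.mulVecBilin ℂ ℂ |>.flip v) hc
  have h3 := (NormedSpace.exp_series_hasSum_exp' (𝕂 := ℂ) l).smul_const v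
  rw [← Complex.exp_eq_exp_ℂ] at h3
  refine h2.unique ?_
  convert h3 using 2 with k
  simp [hp, smul_smul]

/-- `T` commutes with `exp T`, so it preserves the `μ`-eigenspace of `exp T` and has an eigenvector
there; its eigenvalue `l` satisfies `e^l = μ`. -/
theorem exists_exp_eq_of_mem_spectrum_exp {n : Type*} [Fintype n] [DecidableEq n]
    {T : Matrix n n ℂ} {μ : ℂ} (h : μ ∈ spectrum ℂ (NormedSpace.exp T)) :
    ∃ l ∈ spectrum ℂ T, Complex.exp l = μ := by
  rw [← Matrix.spectrum_toLin', ← Module.End.hasEigenvalue_iff_mem_spectrum] at h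
  set W := Module.End.eigenspace (Matrix.toLin' (NormedSpace.exp T)) μ with hW
  have hcomm : Commute T (NormedSpace.exp T) := (Commute.refl T).exp_right
  have hinv : ∀ x ∈ W, Matrix.toLin' T x ∈ W := by
    intro x hx
    rw [hW, Module.End.mem_eigenspace_iff] at hx ⊢
    rw [toLin'_apply] at hx ⊢
    rw [toLin'_apply, mulVec_mulVec, ← hcomm.eq, ← mulVec_mulVec, hx, mulVec_smul]
  have : Nontrivial W := Submodule.nontrivial_iff_ne_bot.mpr h
  obtain ⟨l, hl⟩ := Module.End.exists_eigenvalue ((Matrix.toLin' T).restrict hinv)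
  obtain ⟨w, hw⟩ := hl.exists_hasEigenvector
  have hw0 : (w : n → ℂ) ≠ 0 := fun h0 => hw.2 (Subtype.ext h0)
  have hTw : T *ᵥ (w : n → ℂ) = l • (w : n → ℂ) := by
    simpa using congrArg Subtype.val hw.apply_eq_smul
  refine ⟨l, ?_, ?_⟩
  · rw [← Matrix.spectrum_toLin', ← Module.End.hasEigenvalue_iff_mem_spectrum]
    exact Module.End.hasEigenvalue_of_hasEigenvector
      ⟨Module.End.mem_eigenspace_iff.mpr (by simpa using hTw), hw0⟩
  · have h1 := exp_mulVec_of_mulVec_eq_smul hTw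
    have h2 := Module.End.mem_eigenspace_iff.mp w.2
    rw [toLin'_apply, h1] at h2
    exact smul_left_injective ℂ hw0 h2

theorem map_E {N : ℕ} (B : Matrix (Fin N) (Fin N) ℝ) (t : ℝ) :
    (E B t).map (algebraMap ℝ ℂ) =
      NormedSpace.exp ((-(t : ℂ)) • B.map (algebraMap ℝ ℂ)) := by
  have hc : Continuous ((algebraMap ℝ ℂ).mapMatrix (m := Fin N)) := by
    change Continuous fun M : Matrix (Fin N) (Fin N) ℝ => M.map (algebraMap ℝ ℂ)
    exact Continuous.matrix_map continuous_id (by simpa using Complex.continuous_ofReal)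
  have h := NormedSpace.map_exp ((algebraMap ℝ ℂ).mapMatrix (m := Fin N)) hc (-(t • B))
  rw [RingHom.mapMatrix_apply, RingHom.mapMatrix_apply] at h
  refine Eq.trans h (congrArg NormedSpace.exp ?_)
  ext i j
  simp

/-- When `σ(B) ⊆ iℝ`, the characteristic polynomial of `E(t)ᵀ` has coefficients bounded by
binomial coefficients. -/
theorem abs_coeff_charpoly_E_transpose_le {N : ℕ} {B : Matrix (Fin N) (Fin N) ℝ}
    (hB : ∀ z ∈ spectrum ℂ (B.map (algebraMap ℝ ℂ)), z.re = 0) (t : ℝ) (i : ℕ) :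
    |((E B t)ᵀ).charpoly.coeff i| ≤ N.choose i := by
  rw [charpoly_transpose]
  have h := Polynomial.coeff_le_of_roots_le (p := (E B t).charpoly) (f := algebraMap ℝ ℂ)
    (B := 1) i (charpoly_monic _) (IsAlgClosed.splits _) ?_
  · simpa [charpoly_natDegree_eq_dim] using h
  intro z hz
  rw [← Matrix.charpoly_map, Polynomial.mem_roots (charpoly_monic _).ne_zero,
    ← Matrix.mem_spectrum_iff_isRoot_charpoly, map_E] at hz
  obtain ⟨l, hl, rfl⟩ := exists_exp_eq_of_mem_spectrum_exp hz
  rw [Complex.norm_exp]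
  suffices l.re = 0 by simp [this]
  -- The spectrum scales with the matrix only for invertible scalars.
  by_cases ht : t = 0
  · subst ht
    rcases isEmpty_or_nonempty (Fin N) with h0 | h0
    · simp at hl
    · simp at hl
      simp [hl]
  · have hu : IsUnit (-(t : ℂ)) := by simpa using ht
    obtain ⟨u, hu⟩ := hu
    rw [← hu, ← Units.smul_def, spectrum.unit_smul_eq_smul] at hl
    obtain ⟨w, hw, rfl⟩ := hl
    simp [hu, hB w hw]

/-! ### Quadratic form of the Kalman matrix -/

theorem E_add {N : ℕ} (B : Matrix (Fin N) (Fin N) ℝ) (s t : ℝ) :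
    E B (s + t) = E B s * E B t := by
  unfold E
  rw [add_smul, neg_add]
  exact Matrix.exp_add_of_commute _ _ (((Commute.refl B).smul_left s).smul_right t).neg_left.neg_right

theorem E_nat_mul {N : ℕ} (B : Matrix (Fin N) (Fin N) ℝ) (n : ℕ) (t : ℝ) :
    E B (n * t) = E B t ^ n := by
  unfold E
  rw [← Matrix.exp_nsmul]
  congr 1
  rw [mul_smul, smul_neg, Nat.cast_smul_eq_nsmul]

theorem continuous_E {N : ℕ} (B : Matrix (Fin N) (Fin N) ℝ) : Continuous (E B) := by
  unfold E
  exact NormedSpace.exp_continuous.comp (by fun_prop)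

theorem continuous_E_mul_mul_transpose {N : ℕ} (A B : Matrix (Fin N) (Fin N) ℝ) :
    Continuous fun s => E B s * A * (E B s)ᵀ := by
  have := continuous_E B
  fun_prop

/-- The quadratic form `⟨x, E(s) A E(s)ᵀ x⟩`. -/
noncomputable def diffusionForm {N : ℕ} (A B : Matrix (Fin N) (Fin N) ℝ) (x : Fin N → ℝ)
    (s : ℝ) : ℝ :=
  x ⬝ᵥ ((E B s * A * (E B s)ᵀ) *ᵥ x)

theorem continuous_diffusionForm {N : ℕ} (A B : Matrix (Fin N) (Fin N) ℝ) (x : Fin N → ℝ) :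
    Continuous (diffusionForm A B x) := by
  have := continuous_E_mul_mul_transpose A B
  unfold diffusionForm
  fun_prop

theorem diffusionForm_nonneg {N : ℕ} {A : Matrix (Fin N) (Fin N) ℝ} (hA : A.PosSemidef)
    (B : Matrix (Fin N) (Fin N) ℝ) (x : Fin N → ℝ) (s : ℝ) : 0 ≤ diffusionForm A B x s := by
  have h := (hA.mul_mul_conjTranspose_same (E B s)).dotProduct_mulVec_nonneg x
  rwa [conjTranspose_eq_transpose_of_trivial, star_trivial] at h

theorem diffusionForm_add {N : ℕ} (A B : Matrix (Fin N) (Fin N) ℝ) (x : Fin N → ℝ) (a s : ℝ) :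
    diffusionForm A B x (s + a) = diffusionForm A B ((E B a)ᵀ *ᵥ x) s := by
  unfold diffusionForm
  rw [add_comm, E_add, transpose_mul, mulVec_mulVec, mulVec_transpose, ← dotProduct_mulVec,
    mulVec_mulVec]
  simp only [Matrix.mul_assoc]

theorem dotProduct_C_mulVec {N : ℕ} (A B : Matrix (Fin N) (Fin N) ℝ) (x : Fin N → ℝ) (t : ℝ) :
    x ⬝ᵥ (C A B t *ᵥ x) = ∫ s in (0 : ℝ)..t, diffusionForm A B x s := by
  have hc := continuous_E_mul_mul_transpose A B
  have hi : ∀ i j, Continuous fun s => (E B s * A * (E B s)ᵀ) i j := fun i j =>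
    hc.matrix_elem i j
  unfold diffusionForm
  simp only [dotProduct, mulVec, C, Matrix.of_apply]
  rw [intervalIntegral.integral_finsetSum]
  · refine Finset.sum_congr rfl fun i _ => ?_
    rw [intervalIntegral.integral_const_mul, intervalIntegral.integral_finsetSum]
    · simp only [intervalIntegral.integral_mul_const]
    · exact fun j _ => ((hi i j).mul continuous_const).intervalIntegrable _ _
  · exact fun i _ => (continuous_const.mul
      (continuous_finsetSum _ fun j _ => (hi i j).mul continuous_const)).intervalIntegrable _ _

theorem dotProduct_C_add_mulVec {N : ℕ} (A B : Matrix (Fin N) (Fin N) ℝ) (x : Fin N → ℝ)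
    (a b : ℝ) :
    x ⬝ᵥ (C A B (a + b) *ᵥ x) =
      x ⬝ᵥ (C A B a *ᵥ x) + ((E B a)ᵀ *ᵥ x) ⬝ᵥ (C A B b *ᵥ ((E B a)ᵀ *ᵥ x)) := by
  have hi : ∀ u v, IntervalIntegrable (diffusionForm A B x) MeasureTheory.volume u v :=
    fun u v => (continuous_diffusionForm A B x).intervalIntegrable u v
  simp only [dotProduct_C_mulVec, ← diffusionForm_add]
  rw [intervalIntegral.integral_comp_add_right, zero_add, add_comm b a,
    intervalIntegral.integral_add_adjacent_intervals (hi _ _) (hi _ _)]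

theorem dotProduct_C_mulVec_mono {N : ℕ} {A : Matrix (Fin N) (Fin N) ℝ} (hA : A.PosSemidef)
    (B : Matrix (Fin N) (Fin N) ℝ) (x : Fin N → ℝ) {r R : ℝ} (h0 : 0 ≤ r) (h : r ≤ R) :
    x ⬝ᵥ (C A B r *ᵥ x) ≤ x ⬝ᵥ (C A B R *ᵥ x) := by
  rw [dotProduct_C_mulVec, dotProduct_C_mulVec]
  exact intervalIntegral.integral_mono_interval le_rfl h0 h
    (Filter.Eventually.of_forall fun s => diffusionForm_nonneg hA B x s)
    ((continuous_diffusionForm A B x).intervalIntegrable _ _)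

theorem dotProduct_C_nat_mul_mulVec {N : ℕ} (A B : Matrix (Fin N) (Fin N) ℝ) (x : Fin N → ℝ)
    (n : ℕ) (h : ℝ) :
    x ⬝ᵥ (C A B (n * h) *ᵥ x) = ∑ j ∈ Finset.range n,
      (((E B h)ᵀ ^ j) *ᵥ x) ⬝ᵥ (C A B h *ᵥ (((E B h)ᵀ ^ j) *ᵥ x)) := by
  induction n with
  | zero => simp [dotProduct_C_mulVec]
  | succ n ih =>
    rw [Finset.sum_range_succ, ← ih, Nat.cast_succ, add_mul, one_mul, dotProduct_C_add_mulVec,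
      E_nat_mul, transpose_pow]

/-! ### Doubling -/

/-- By Cayley–Hamilton, the `N`-th power of a real `N × N` matrix is a combination of lower powers,
with the coefficients of the characteristic polynomial. -/
theorem pow_mulVec_eq_sum {N : ℕ} (W : Matrix (Fin N) (Fin N) ℝ) (x : Fin N → ℝ) :
    (W ^ N) *ᵥ x = ∑ j ∈ Finset.range N, (-W.charpoly.coeff j) • ((W ^ j) *ᵥ x) := by
  have h := Matrix.aeval_self_charpoly W
  rw [Polynomial.aeval_eq_sum_range, charpoly_natDegree_eq_dim, Fintype.card_fin,
    Finset.sum_range_succ] at h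
  have hN : W.charpoly.coeff N = 1 := by
    have := (charpoly_monic W).coeff_natDegree
    rwa [charpoly_natDegree_eq_dim, Fintype.card_fin] at this
  rw [hN, one_smul, add_comm] at h
  rw [eq_neg_of_add_eq_zero_left h, neg_mulVec, sum_mulVec, ← Finset.sum_neg_distrib]
  exact Finset.sum_congr rfl fun j _ => by rw [smul_mulVec, neg_smul]

/-- The sum of the squares of the first `N` binomial coefficients of order `N`. -/
def binomialSquareSum (N : ℕ) : ℝ := ∑ j ∈ Finset.range N, (N.choose j : ℝ) ^ 2

theorem binomialSquareSum_nonneg (N : ℕ) : 0 ≤ binomialSquareSum N :=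
  Finset.sum_nonneg fun _ _ => sq_nonneg _

theorem quadraticForm_E_pow_le {N : ℕ} {B G : Matrix (Fin N) (Fin N) ℝ}
    (hB : ∀ z ∈ spectrum ℂ (B.map (algebraMap ℝ ℂ)), z.re = 0) (hG : G.PosSemidef)
    (h : ℝ) (x : Fin N → ℝ) :
    (((E B h)ᵀ ^ N) *ᵥ x) ⬝ᵥ (G *ᵥ (((E B h)ᵀ ^ N) *ᵥ x)) ≤
      binomialSquareSum N * ∑ j ∈ Finset.range N,
        (((E B h)ᵀ ^ j) *ᵥ x) ⬝ᵥ (G *ᵥ (((E B h)ᵀ ^ j) *ᵥ x)) := by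
  rw [pow_mulVec_eq_sum]
  refine (quadraticForm_sum_smul_le hG _ _ _).trans ?_
  gcongr
  · exact Finset.sum_nonneg fun j _ => by
      simpa using hG.dotProduct_mulVec_nonneg (((E B h)ᵀ ^ j) *ᵥ x)
  · refine Finset.sum_le_sum fun j _ => ?_
    rw [neg_sq, ← sq_abs]
    gcongr
    exact abs_coeff_charpoly_E_transpose_le hB h j

/-- Doubling for the quadratic form of the Kalman matrix, with a constant depending only on `N`. -/
theorem dotProduct_C_two_mul_mulVec_le {N : ℕ} {A B : Matrix (Fin N) (Fin N) ℝ}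
    (hC : ∀ t : ℝ, 0 < t → (C A B t).PosDef)
    (hB : ∀ z ∈ spectrum ℂ (B.map (algebraMap ℝ ℂ)), z.re = 0) {t : ℝ} (ht : 0 < t)
    (x : Fin N → ℝ) :
    x ⬝ᵥ (C A B (2 * t) *ᵥ x) ≤
      (1 + (1 + binomialSquareSum N) ^ N) * (x ⬝ᵥ (C A B t *ᵥ x)) := by
  rcases Nat.eq_zero_or_pos N with rfl | hN
  · simp [dotProduct]
  have hN' : (0 : ℝ) < N := by exact_mod_cast hN
  -- With `N` equal steps, `q_t` contains exactly the powers of `W` that Cayley–Hamilton uses.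
  obtain ⟨h, hh, rfl⟩ : ∃ h : ℝ, 0 < h ∧ t = N * h :=
    ⟨t / N, div_pos ht hN', by field_simp⟩
  have hG := (hC h hh).posSemidef
  have hK := binomialSquareSum_nonneg N
  set W := (E B h)ᵀ with hW
  have step : ∀ y : Fin N → ℝ, (W *ᵥ y) ⬝ᵥ (C A B (N * h) *ᵥ (W *ᵥ y)) ≤
      (1 + binomialSquareSum N) * (y ⬝ᵥ (C A B (N * h) *ᵥ y)) := by
    intro y
    have h1 := quadraticForm_E_pow_le hB hG h y
    rw [← dotProduct_C_nat_mul_mulVec] at h1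
    -- Splitting `q_{h+Nh}(y)` after the first step and before the last gives `q_h(y) + q_{Nh}(W y)
    -- = q_{Nh}(y) + q_h(W^N y)`.
    have h2 := dotProduct_C_add_mulVec A B y h (N * h)
    have h3 := dotProduct_C_add_mulVec A B y (N * h) h
    rw [E_nat_mul, transpose_pow, add_comm (N * h) h, h2] at h3
    have h4 := hG.dotProduct_mulVec_nonneg y
    rw [star_trivial] at h4
    linarith
  have iter : ∀ k : ℕ, ((W ^ k) *ᵥ x) ⬝ᵥ (C A B (N * h) *ᵥ ((W ^ k) *ᵥ x)) ≤
      (1 + binomialSquareSum N) ^ k * (x ⬝ᵥ (C A B (N * h) *ᵥ x)) := by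
    intro k
    induction k with
    | zero => simp
    | succ k ih =>
      rw [pow_succ', ← mulVec_mulVec, pow_succ', mul_assoc]
      exact (step _).trans (by gcongr)
  rw [two_mul, dotProduct_C_add_mulVec, E_nat_mul, transpose_pow, add_mul, one_mul]
  gcongr
  exact iter N

theorem D_two_mul_le {N : ℕ} {A B : Matrix (Fin N) (Fin N) ℝ}
    (hC : ∀ t : ℝ, 0 < t → (C A B t).PosDef)
    (hB : ∀ z ∈ spectrum ℂ (B.map (algebraMap ℝ ℂ)), z.re = 0) {t : ℝ} (ht : 0 < t) :
    D A B (2 * t) ≤ (1 + (1 + binomialSquareSum N) ^ N) ^ N * D A B t := by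
  have h := det_le_det_of_quadraticForm_le (hC (2 * t) (by positivity))
    (R := (1 + (1 + binomialSquareSum N) ^ N) • C A B t)
    ((hC t ht).1.smul (IsSelfAdjoint.all _)) fun x => by
      simpa [smul_mulVec, dotProduct_smul] using dotProduct_C_two_mul_mulVec_le hC hB ht x
  simpa [D, det_smul] using h

theorem D_mono {N : ℕ} {A B : Matrix (Fin N) (Fin N) ℝ} (hA : A.PosSemidef)
    (hC : ∀ t : ℝ, 0 < t → (C A B t).PosDef) {r R : ℝ} (hr : 0 < r) (h : r ≤ R) :
    D A B r ≤ D A B R :=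
  det_le_det_of_quadraticForm_le (hC r hr) (hC R (hr.trans_le h)).1
    fun x => dotProduct_C_mulVec_mono hA B x hr.le h

/-! ### Power growth and the main theorem -/

/-- A monotone doubling function on `(0, ∞)` grows at most like a power. -/
theorem div_le_mul_rpow_of_doubling {f : ℝ → ℝ} {c : ℝ} (hc : 1 < c)
    (hpos : ∀ t, 0 < t → 0 < f t) (hmono : ∀ r R, 0 < r → r ≤ R → f r ≤ f R)
    (hdbl : ∀ t, 0 < t → f (2 * t) ≤ c * f t) {r R : ℝ} (hr : 0 < r) (h : r ≤ R) :
    f R / f r ≤ c * (R / r) ^ Real.logb 2 c := by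
  have hc0 : 0 < c := one_pos.trans hc
  have iter : ∀ k : ℕ, f (2 ^ k * r) ≤ c ^ k * f r := by
    intro k
    induction k with
    | zero => simp
    | succ k ih =>
      rw [pow_succ', mul_assoc, pow_succ', mul_assoc]
      exact (hdbl _ (by positivity)).trans (by gcongr)
  have h1 : 1 ≤ R / r := (one_le_div hr).mpr h
  -- Here `2^n ≤ R/r < 2^(n+1)`; rounding up to the next dyadic scale costs the extra factor `c`.
  obtain ⟨n, hn1, hn2⟩ := exists_nat_pow_near h1 one_lt_two
  rw [div_le_iff₀ (hpos r hr)]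
  have h2 : f R ≤ c ^ (n + 1) * f r :=
    (hmono R _ (hr.trans_le h) ((div_le_iff₀ hr).mp hn2.le)).trans (iter _)
  have h3 : c ^ n ≤ (R / r) ^ Real.logb 2 c := by
    calc c ^ n = ((2 : ℝ) ^ n) ^ Real.logb 2 c := by
          rw [← Real.rpow_natCast 2 n, ← Real.rpow_mul two_pos.le, mul_comm,
            Real.rpow_mul two_pos.le, Real.rpow_logb two_pos (by norm_num) hc0, Real.rpow_natCast]
      _ ≤ _ := Real.rpow_le_rpow (by positivity) hn1 (Real.logb_nonneg one_lt_two hc.le)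
  have := hpos r hr
  calc f R ≤ c ^ (n + 1) * f r := h2
    _ = c * c ^ n * f r := by rw [pow_succ']
    _ ≤ _ := by gcongr

end OrnsteinUhlenbeck

theorem corollary3p3 {N : ℕ} (A B : Matrix (Fin N) (Fin N) ℝ)
    (hA : A.PosSemidef)
    (hC : ∀ t : ℝ, 0 < t → (OrnsteinUhlenbeck.C A B t).PosDef)
    (hB : ∀ z ∈ spectrum ℂ (B.map (algebraMap ℝ ℂ)), z.re = 0) :
    (∀ t : ℝ, 0 < t → 0 < OrnsteinUhlenbeck.D A B t) ∧
    ∃ cd : ℝ, 1 < cd ∧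
      (∀ t : ℝ, 0 < t →
        OrnsteinUhlenbeck.D A B (2 * t) ≤ cd * OrnsteinUhlenbeck.D A B t) ∧
      (∀ r R : ℝ, 0 < r → r ≤ R →
        OrnsteinUhlenbeck.D A B R / OrnsteinUhlenbeck.D A B r ≤
          cd * (R / r) ^ Real.logb 2 cd) ∧
      ∀ p : ℕ,
        (∀ t : ℝ, 0 < t →
          OrnsteinUhlenbeck.V A B p (2 * t) ≤
            (2 : ℝ) ^ ((p : ℝ) / 2) * Real.sqrt cd * OrnsteinUhlenbeck.V A B p t) ∧
        (∀ r R : ℝ, 0 < r → r ≤ R →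
          OrnsteinUhlenbeck.V A B p R / OrnsteinUhlenbeck.V A B p r ≤
            Real.sqrt cd * (R / r) ^ OrnsteinUhlenbeck.Q cd p) := by
  have hD : ∀ t : ℝ, 0 < t → 0 < OrnsteinUhlenbeck.D A B t := fun t ht => (hC t ht).det_pos
  set c₀ : ℝ := (1 + (1 + OrnsteinUhlenbeck.binomialSquareSum N) ^ N) ^ N with hc₀
  have hK := OrnsteinUhlenbeck.binomialSquareSum_nonneg N
  have hc₀pos : 0 < c₀ := by positivity
  have hdbl : ∀ t : ℝ, 0 < t →
      OrnsteinUhlenbeck.D A B (2 * t) ≤ (1 + c₀) * OrnsteinUhlenbeck.D A B t := by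
    intro t ht
    have h := OrnsteinUhlenbeck.D_two_mul_le hC hB ht
    have := hD t ht
    linarith
  have hgrowth : ∀ r R : ℝ, 0 < r → r ≤ R →
      OrnsteinUhlenbeck.D A B R / OrnsteinUhlenbeck.D A B r ≤
        (1 + c₀) * (R / r) ^ Real.logb 2 (1 + c₀) := fun r R hr h =>
    OrnsteinUhlenbeck.div_le_mul_rpow_of_doubling (by linarith) hD
      (fun r R hr h => OrnsteinUhlenbeck.D_mono hA hC hr h) hdbl hr h
  -- Adding one keeps the constant strictly above one even for `N = 0`, where `c₀ = 1`.
  refine ⟨hD, 1 + c₀, by linarith, hdbl, hgrowth, fun p => ⟨fun t ht => ?_, fun r R hr h => ?_⟩⟩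
  · have h2 : (2 : ℝ) ^ ((p : ℝ) / 2) = Real.sqrt (2 ^ p) := by
      rw [Real.sqrt_eq_rpow, ← Real.rpow_natCast, ← Real.rpow_mul two_pos.le]
      congr 1; ring
    unfold OrnsteinUhlenbeck.V
    rw [h2, ← Real.sqrt_mul (by positivity), ← Real.sqrt_mul (by positivity)]
    apply Real.sqrt_le_sqrt
    calc (4 * Real.pi) ^ (N + p) * (2 * t) ^ p * OrnsteinUhlenbeck.D A B (2 * t)
        ≤ (4 * Real.pi) ^ (N + p) * (2 * t) ^ p * ((1 + c₀) * OrnsteinUhlenbeck.D A B t) := by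
          gcongr
          exact hdbl t ht
      _ = _ := by ring
  · have hR := hr.trans_le h
    have hDr := hD r hr
    have hRr : 0 < R / r := div_pos hR hr
    have hQ : (R / r) ^ OrnsteinUhlenbeck.Q (1 + c₀) p =
        Real.sqrt ((R / r) ^ p * (R / r) ^ Real.logb 2 (1 + c₀)) := by
      rw [Real.sqrt_eq_rpow, ← Real.rpow_natCast, ← Real.rpow_add hRr, ← Real.rpow_mul hRr.le]
      congr 1
      unfold OrnsteinUhlenbeck.Q; ring
    unfold OrnsteinUhlenbeck.V
    rw [hQ, ← Real.sqrt_div' _ (by positivity), ← Real.sqrt_mul (by positivity)]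
    apply Real.sqrt_le_sqrt
    calc (4 * Real.pi) ^ (N + p) * R ^ p * OrnsteinUhlenbeck.D A B R /
          ((4 * Real.pi) ^ (N + p) * r ^ p * OrnsteinUhlenbeck.D A B r)
        = (R / r) ^ p * (OrnsteinUhlenbeck.D A B R / OrnsteinUhlenbeck.D A B r) := by
          rw [div_pow]; field_simp
      _ ≤ (R / r) ^ p * ((1 + c₀) * (R / r) ^ Real.logb 2 (1 + c₀)) := by
          gcongr
          exact hgrowth r R hr h
      _ = _ := by ring
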